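/- Let $\Gamma$ be a finite, undirected, connected graph without loops or multiple edges, with path-length distance $\partial$ and diameter $d \ge 3$. Assume $\Gamma$ is distance-regular: for all $0 \le h,i,j \le d$ and all vertices $x,y$ with $\partial(x,y)=h$, the number $p^h_{ij}$ of vertices $z$ with $\partial(x,z)=i$ and $\partial(y,z)=j$ does not depend on the choice of $x,y$. Put $a_i = p^i_{1,i}$ for $0\le i\le d$ and $b_1=p^1_{1,2}$, and let $k=p^0_{1,1}$ be the valency. Call $\Gamma$ bipartite if $a_i=0$ for all $0\le i\le d$. Let $\theta_0>\theta_1>\cdots>\theta_d$ be the distinct eigenvalues of the adjacency matrix of $\Gamma$ (so $\theta_0=k$). Then the following hold. (i) Suppose $\Gamma$ is not bipartite. Then the denominators below are nonzero and $$\frac{k+\theta_d(a_1+1)}{(k+\theta_d)(1+\theta_d)} \le \frac{k+\theta_1(a_1+1)}{(k+\theta_1)(1+\theta_1)}.$$ (ii) In all cases (bipartite or not), $$\left(\theta_1+\frac{k}{a_1+1}\right)\left(\theta_d+\frac{k}{a_1+1}\right) \ge -\frac{k a_1 b_1}{(a_1+1)^2}.$$ -/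

import Mathlib

namespace SimpleGraph

variable {V : Type*} [Fintype V]

/-- The number of vertices at distance `i` from `x` and at distance `j` from `y`. -/
noncomputable def sphereInterCard (G : SimpleGraph V) (i j : ℕ) (x y : V) : ℕ :=
  (Finset.univ.filter fun z => G.dist x z = i ∧ G.dist y z = j).card

/-- A finite connected graph of diameter `d` is distance-regular if for all `0 ≤ h, i, j ≤ d` and
all vertices `x, y` at distance `h`, the number of vertices at distance `i` from `x` and `j` from
`y` does not depend on the choice of `x` and `y`. -/
def IsDistanceRegular (G : SimpleGraph V) : Prop :=
  G.Connected ∧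
    ∀ h i j : ℕ, h ≤ G.diam → i ≤ G.diam → j ≤ G.diam →
      ∃ n : ℕ, ∀ x y : V, G.dist x y = h → G.sphereInterCard i j x y = n

/-- The intersection number `p^h_{ij}`: the common value of `sphereInterCard i j x y` over all
pairs `x, y` at distance `h` (see `IsDistanceRegular.sphereInterCard_eq`), written as a
supremum over these pairs; it is `0` if there is no such pair. -/
noncomputable def intersectionNumber (G : SimpleGraph V) (h i j : ℕ) : ℕ :=
  sSup {n : ℕ | ∃ x y : V, G.dist x y = h ∧ G.sphereInterCard i j x y = n}

/-- In a distance-regular graph the intersection numbers are what they should be. -/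
theorem IsDistanceRegular.sphereInterCard_eq {G : SimpleGraph V} (hG : G.IsDistanceRegular)
    {h i j : ℕ} (hh : h ≤ G.diam) (hi : i ≤ G.diam) (hj : j ≤ G.diam) {x y : V}
    (hxy : G.dist x y = h) : G.sphereInterCard i j x y = G.intersectionNumber h i j := by
  obtain ⟨n, hn⟩ := hG.2 h i j hh hi hj
  have hs : {m : ℕ | ∃ x y : V, G.dist x y = h ∧ G.sphereInterCard i j x y = m} = {n} := by
    ext m
    constructor
    · rintro ⟨u, v, huv, rfl⟩
      exact hn u v huv
    · rintro rfl
      exact ⟨x, y, hxy, hn x y hxy⟩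
  rw [intersectionNumber, hs, csSup_singleton, hn x y hxy]

/-- The valency `k = p^0_{11}`. -/
noncomputable def drgValency (G : SimpleGraph V) : ℕ := G.intersectionNumber 0 1 1

/-- The intersection number `a_i = p^i_{1,i}`. -/
noncomputable def drgA (G : SimpleGraph V) (i : ℕ) : ℕ := G.intersectionNumber i 1 i

/-- The intersection number `b_i = p^i_{1,i+1}` (so `b_d = 0` for the diameter `d`). -/
noncomputable def drgB (G : SimpleGraph V) (i : ℕ) : ℕ := G.intersectionNumber i 1 (i + 1)

/-- A distance-regular graph of diameter `d` is bipartite if `a_i = 0` for `0 ≤ i ≤ d`. -/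
def IsDRGBipartite (G : SimpleGraph V) : Prop := ∀ i ≤ G.diam, G.drgA i = 0

end SimpleGraph

/-!
Let `k` be the valency, `a₁ = drgA 1`, `b₁ = drgB 1`. Fix an edge `xy` and let `N` be the number of
ordered pairs of common neighbours of `x` and `y` that are at distance `2` from each other.

For an eigenvalue `t` of the adjacency matrix `A`, deleting a factor `X - t` from the minimal
polynomial of `A` gives a polynomial `q` with `q(A) ≠ 0` and `A q(A) = t q(A)`. The matrix `q(A)²` is
positive semidefinite, its entries depend on the distance only, and up to a positive scalar the
entries at distance `0, 1, 2` are `k`, `t` and `(t² - a₁ t - k) / b₁`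
(`SimpleGraph.IsDistanceRegular.exists_cosine`). Evaluating this form on the span of `x̂ + ŷ` and the
characteristic vector of the common neighbours, nonnegativity of the `2 × 2` determinant says, when
`-k < t < k`, that `N (k + t) (1 + t) ≤ a₁ b₁ (k + t (a₁ + 1))`
(`SimpleGraph.IsDistanceRegular.commonNbrsDistTwo_mul_le`).

As `θ₁ ≥ 0` and `θ_d < -1`, the inequality for `θ₁` bounds `N` from above and the one for `θ_d`
bounds it from below. Comparing the two bounds and cancelling the factor `a₁ b₁ (θ₁ - θ_d)` gives
`(a₁ + 1) θ₁ θ_d + k (θ₁ + θ_d) + k (k - a₁) ≥ 0`, which for `a₁ = 0` is merely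
`(θ₁ + k) (θ_d + k) ≥ 0` (`SimpleGraph.IsDistanceRegular.fundamental_bound`). Both parts of the theorem
are rearrangements of this inequality. The location of the eigenvalues comes from Rayleigh quotients
of vectors supported on an induced path, and from the fact that `-k` is an eigenvalue only if the
graph is bipartite.
-/

open Polynomial

namespace SimpleGraph

variable {V : Type*} [Fintype V] {G : SimpleGraph V}

/-! ### Neighbourhoods in a distance-regular graph -/

theorem IsDistanceRegular.dist_le_diam (hG : G.IsDistanceRegular) (x y : V) :
    G.dist x y ≤ G.diam := by
  have : Nonempty V := hG.1.nonempty
  exact SimpleGraph.dist_le_diam (connected_iff_ediam_ne_top.1 hG.1)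

theorem IsDistanceRegular.degree_eq [DecidableRel G.Adj] (hG : G.IsDistanceRegular)
    (hd : 1 ≤ G.diam) (x : V) : G.degree x = G.drgValency := by
  rw [drgValency, ← hG.sphereInterCard_eq (Nat.zero_le _) hd hd (dist_self (v := x)),
    sphereInterCard, ← card_neighborFinset_eq_degree]
  congr 1
  ext z
  simp [dist_eq_one_iff_adj]

/-- The common neighbours of `x` and `y`. -/
noncomputable def commonNbrs (G : SimpleGraph V) (x y : V) : Finset V :=
  Finset.univ.filter fun z => G.dist x z = 1 ∧ G.dist y z = 1

theorem mem_commonNbrs {x y z : V} : z ∈ G.commonNbrs x y ↔ G.Adj x z ∧ G.Adj y z := by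
  simp [commonNbrs, dist_eq_one_iff_adj]

theorem IsDistanceRegular.card_commonNbrs (hG : G.IsDistanceRegular) {x y : V}
    (hxy : G.Adj x y) : (G.commonNbrs x y).card = G.drgA 1 := by
  have h1 := dist_eq_one_iff_adj.2 hxy
  have hd : 1 ≤ G.diam := h1 ▸ hG.dist_le_diam x y
  rw [drgA, ← hG.sphereInterCard_eq hd hd hd h1, sphereInterCard, commonNbrs]

/-- The neighbours of `x` are at distance `0`, `1` or `2` from a given neighbour `y` of `x`, which
turns the eigenvector equation at `x` into the first three-term relation of a cosine sequence. -/
theorem IsDistanceRegular.sum_nbrs [DecidableEq V] [DecidableRel G.Adj]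
    (hG : G.IsDistanceRegular)
    (hd : 2 ≤ G.diam) {x y : V} (hxy : G.Adj x y) (g : ℕ → ℝ) :
    ∑ z ∈ G.neighborFinset x, g (G.dist z y) =
      g 0 + G.drgA 1 * g 1 + G.drgB 1 * g 2 := by
  have h1 := dist_eq_one_iff_adj.2 hxy
  have hA : (Finset.univ.filter fun z => G.dist x z = 1 ∧ G.dist y z = 1).card = G.drgA 1 :=
    hG.card_commonNbrs hxy
  have hB : (Finset.univ.filter fun z => G.dist x z = 1 ∧ G.dist y z = 2).card = G.drgB 1 :=
    hG.sphereInterCard_eq (by lia) (by lia) hd h1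
  have key : ∀ z ∈ G.neighborFinset x, g (G.dist z y) =
      (if z = y then g 0 else 0) + (if G.dist y z = 1 then g 1 else 0)
        + (if G.dist y z = 2 then g 2 else 0) := by
    intro z hz
    have hxz := dist_eq_one_iff_adj.2 ((G.mem_neighborFinset x z).1 hz)
    have := hG.1.dist_triangle (u := y) (v := x) (w := z)
    rw [dist_comm (u := y) (v := x), hxz, h1] at this
    rw [dist_comm (u := z)]
    rcases eq_or_ne z y with rfl | hne
    · simp
    · have h0 := hG.1.pos_dist_of_ne hne.symm
      have h12 : G.dist y z = 1 ∨ G.dist y z = 2 := by lia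
      rcases h12 with h | h <;> simp [h, hne]
  rw [Finset.sum_congr rfl key, Finset.sum_add_distrib, Finset.sum_add_distrib,
    ← Finset.sum_filter, ← Finset.sum_filter, ← Finset.sum_filter]
  simp only [Finset.sum_const, nsmul_eq_mul]
  have e0 : (G.neighborFinset x).filter (fun z => z = y) = {y} := by
    ext z; simp +contextual [hxy]
  have e1 : (G.neighborFinset x).filter (fun z => G.dist y z = 1) =
      Finset.univ.filter fun z => G.dist x z = 1 ∧ G.dist y z = 1 := by
    ext z; simp [dist_eq_one_iff_adj]
  have e2 : (G.neighborFinset x).filter (fun z => G.dist y z = 2) =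
      Finset.univ.filter fun z => G.dist x z = 1 ∧ G.dist y z = 2 := by
    ext z; simp [dist_eq_one_iff_adj]
  rw [e0, e1, e2, hA, hB]
  simp

theorem IsDistanceRegular.valency_eq (hG : G.IsDistanceRegular) (hd : 2 ≤ G.diam) {x y : V}
    (hxy : G.Adj x y) : (G.drgValency : ℝ) = 1 + G.drgA 1 + G.drgB 1 := by
  classical
  have h := hG.sum_nbrs hd hxy (fun _ => 1)
  rw [← hG.degree_eq (by lia) x]
  simpa using h

/-- Two edges `xy`, `yz` that span an induced path. -/
theorem IsDistanceRegular.exists_induced_path (hG : G.IsDistanceRegular) (hd : 2 ≤ G.diam) :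
    ∃ x y z : V, G.Adj x y ∧ G.Adj y z ∧ ¬ G.Adj x z ∧ x ≠ z := by
  have : Nonempty V := hG.1.nonempty
  obtain ⟨u, v, huv⟩ := G.exists_dist_eq_diam
  obtain ⟨p, hp⟩ := hG.1.exists_walk_length_eq_dist u v
  obtain ⟨x, y, z, h⟩ := p.exists_adj_adj_not_adj_ne hp (by lia)
  exact ⟨_, _, _, h⟩

theorem IsDistanceRegular.drgB_one_pos (hG : G.IsDistanceRegular) (hd : 2 ≤ G.diam) :
    0 < G.drgB 1 := by
  obtain ⟨x, y, z, hxy, hyz, hn, hne⟩ := hG.exists_induced_path hd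
  rw [drgB, ← hG.sphereInterCard_eq (x := y) (y := x) (by lia) (by lia) (by lia)
    (dist_eq_one_iff_adj.2 hxy.symm), sphereInterCard, Finset.card_pos]
  refine ⟨z, ?_⟩
  have h1 := dist_eq_one_iff_adj.2 hxy
  have h2 := dist_eq_one_iff_adj.2 hyz
  have h3 := hG.1.one_lt_dist_of_ne_of_not_adj hne hn
  have := hG.1.dist_triangle (u := x) (v := y) (w := z)
  simp only [Finset.mem_filter, Finset.mem_univ, true_and]
  lia

/-! ### Polynomials in the adjacency matrix and cosine sequences -/

/-- Polynomials in the adjacency matrix lie in the Bose–Mesner algebra: their entries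
depend on the distance only. -/
theorem IsDistanceRegular.exists_aeval_apply_eq [DecidableEq V] [DecidableRel G.Adj]
    (hG : G.IsDistanceRegular) (hd : 1 ≤ G.diam) (q : ℝ[X]) :
    ∃ g : ℕ → ℝ, ∀ x y, aeval (G.adjMatrix ℝ) q x y = g (G.dist x y) := by
  induction q using Polynomial.induction_on with
  | C a =>
    refine ⟨fun i => if i = 0 then a else 0, fun x y => ?_⟩
    rw [aeval_C, Matrix.algebraMap_matrix_apply]
    simp [hG.1.dist_eq_zero_iff]
  | add p q hp hq =>
    obtain ⟨g, hg⟩ := hp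
    obtain ⟨f, hf⟩ := hq
    exact ⟨fun i => g i + f i, fun x y => by simp [hg, hf]⟩
  | monomial n a h =>
    obtain ⟨g, hg⟩ := h
    refine ⟨fun i => ∑ j ∈ Finset.range (G.diam + 1), G.intersectionNumber i 1 j * g j,
      fun x y => ?_⟩
    have e : (C a * X ^ (n + 1) : ℝ[X]) = X * (C a * X ^ n) := by ring
    rw [e, map_mul, aeval_X, adjMatrix_mul_apply]
    simp only [hg]
    rw [← Finset.sum_fiberwise_of_maps_to (s := G.neighborFinset x)
      (t := Finset.range (G.diam + 1)) (g := fun z => G.dist z y)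
      (fun z _ => Finset.mem_range.2 (Nat.lt_succ_of_le (hG.dist_le_diam z y)))]
    refine Finset.sum_congr rfl fun j hj => ?_
    rw [← hG.sphereInterCard_eq (hG.dist_le_diam x y) hd
      (Nat.le_of_lt_succ (Finset.mem_range.1 hj)) rfl, sphereInterCard]
    rw [Finset.sum_congr rfl (g := fun _ => g j) (by simp +contextual), Finset.sum_const,
      nsmul_eq_mul]
    congr 3
    ext z
    simp [dist_eq_one_iff_adj, dist_comm (u := z)]

/-- For each eigenvalue `t` of `A` some nonzero polynomial in `A` has all its columns in the
eigenspace of `t`: the minimal polynomial with one factor `X - t` removed, evaluated at `A`. This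
plays the role of the primitive idempotent of `t`. -/
theorem _root_.Matrix.exists_aeval_mul_eq_smul {n : Type*} [Fintype n] [DecidableEq n]
    (A : Matrix n n ℝ) {t : ℝ}
    (ht : Module.End.HasEigenvalue (Matrix.toLin' A) t) :
    ∃ q : ℝ[X], aeval A q ≠ 0 ∧ A * aeval A q = t • aeval A q := by
  have hr := Module.End.hasEigenvalue_iff_isRoot.1 ht
  rw [Matrix.minpoly_toLin'] at hr
  obtain ⟨q, hq⟩ := dvd_iff_isRoot.2 hr
  have hint : IsIntegral ℝ A := Matrix.isIntegral A
  have hq0 : q ≠ 0 := by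
    rintro rfl
    exact minpoly.ne_zero hint (by simpa using hq)
  refine ⟨q, fun h => ?_, ?_⟩
  · have h1 := natDegree_le_natDegree (minpoly.degree_le_of_ne_zero ℝ A hq0 h)
    rw [hq, natDegree_mul (X_sub_C_ne_zero t) hq0, natDegree_X_sub_C] at h1
    lia
  · have h := minpoly.aeval ℝ A
    rw [hq, map_mul, map_sub, aeval_X, aeval_C, sub_mul, sub_eq_zero] at h
    rw [h, Algebra.smul_def]

theorem _root_.Matrix.IsSymm.aeval {n : Type*} [Fintype n] [DecidableEq n]
    {A : Matrix n n ℝ} (hA : A.IsSymm) (q : ℝ[X]) : (Polynomial.aeval A q).IsSymm := by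
  induction q using Polynomial.induction_on' with
  | add p q hp hq => rw [map_add]; exact hp.add hq
  | monomial n a =>
    rw [aeval_monomial, ← Algebra.smul_def]
    exact (hA.pow n).smul a

/-- The cosine sequence of an eigenvalue `t`, scaled to start with `k, t`, with its three-term
relation. The matrix with entries `g (dist x y)` is a positive multiple of the square of a symmetric
matrix whose columns lie in the eigenspace of `t`, hence positive semidefinite. -/
theorem IsDistanceRegular.exists_cosine [DecidableEq V] [DecidableRel G.Adj]
    (hG : G.IsDistanceRegular) (hd : 2 ≤ G.diam) {t : ℝ}
    (ht : Module.End.HasEigenvalue (Matrix.toLin' (G.adjMatrix ℝ)) t) :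
    ∃ g : ℕ → ℝ, g 0 = G.drgValency ∧ g 1 = t ∧
      G.drgValency + G.drgA 1 * t + G.drgB 1 * g 2 = t ^ 2 ∧
      ∀ v : V → ℝ, 0 ≤ ∑ z, v z * ∑ w, v w * g (G.dist z w) := by
  obtain ⟨q, hq0, hq⟩ := (G.adjMatrix ℝ).exists_aeval_mul_eq_smul ht
  obtain ⟨g, hg⟩ := hG.exists_aeval_apply_eq (by lia) (q * q)
  have hsymm := (G.isSymm_adjMatrix (α := ℝ)).aeval q
  set B := aeval (G.adjMatrix ℝ) q with hB
  rw [map_mul, ← hB] at hg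
  have hrec : ∀ x y, ∑ z ∈ G.neighborFinset x, g (G.dist z y) = t * g (G.dist x y) := by
    intro x y
    have h : (G.adjMatrix ℝ * (B * B)) x y = (t • (B * B)) x y := by
      rw [← mul_assoc, hq, smul_mul_assoc]
    rw [adjMatrix_mul_apply] at h
    simpa [hg] using h
  obtain ⟨x, y, -, hxy, -⟩ := hG.exists_induced_path hd
  have h1 := dist_eq_one_iff_adj.2 hxy
  have e0 : G.drgValency * g 1 = t * g 0 := by
    have h := hrec x x
    rw [dist_self, Finset.sum_congr rfl (g := fun _ => g 1), Finset.sum_const, nsmul_eq_mul,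
      card_neighborFinset_eq_degree, hG.degree_eq (by lia)] at h
    · exact h
    · intro z hz
      rw [dist_eq_one_iff_adj.2 ((G.mem_neighborFinset x z).1 hz).symm]
  have e1 : g 0 + G.drgA 1 * g 1 + G.drgB 1 * g 2 = t * g 1 := by
    rw [← hG.sum_nbrs hd hxy, hrec, h1]
  have hsq : ∀ v : V → ℝ, ∑ z, v z * ∑ w, v w * g (G.dist z w) =
      (B.mulVec v) ⬝ᵥ (B.mulVec v) := by
    intro v
    rw [Matrix.dotProduct_mulVec, ← Matrix.mulVec_transpose, hsymm.eq, Matrix.mulVec_mulVec,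
      dotProduct_comm]
    simp only [dotProduct, Matrix.mulVec, hg]
    simp only [mul_comm (g _)]
  -- a vanishing diagonal of `B * B` would force `B = 0`
  have hdiag : ∀ z, g 0 = B z ⬝ᵥ B z := by
    intro z
    have h := hg z z
    rw [dist_self, Matrix.mul_apply] at h
    rw [← h]
    refine Finset.sum_congr rfl fun w _ => ?_
    rw [hsymm.apply z w]
  have hg0 : 0 < g 0 := by
    refine lt_of_le_of_ne ?_ fun h => hq0 ?_
    · rw [hdiag x]
      exact Finset.sum_nonneg fun _ _ => mul_self_nonneg _
    · ext z w
      have := dotProduct_self_eq_zero.1 ((hdiag z).symm.trans h.symm)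
      exact congrFun this w
  have hk : (0 : ℝ) < G.drgValency := by
    rw [hG.valency_eq hd hxy]; positivity
  refine ⟨fun i => G.drgValency / g 0 * g i, by field_simp, ?_, ?_, fun v => ?_⟩
  · field_simp; linarith
  · have : g 1 = t * g 0 / G.drgValency := by field_simp; linarith
    have e2 : G.drgB 1 * g 2 = t * g 1 - g 0 - G.drgA 1 * g 1 := by linarith
    have e3 : G.drgB 1 * (G.drgValency / g 0 * g 2)
      = G.drgValency / g 0 * (G.drgB 1 * g 2) := by ring
    rw [e3, e2, this]
    field_simp
    ring
  · have h : ∑ z, v z * ∑ w, v w * (G.drgValency / g 0 * g (G.dist z w)) =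
        G.drgValency / g 0 * ∑ z, v z * ∑ w, v w * g (G.dist z w) := by
      simp only [Finset.mul_sum]
      exact Finset.sum_congr rfl fun _ _ => Finset.sum_congr rfl fun _ _ => by ring
    rw [h, hsq]
    exact mul_nonneg (by positivity) (Finset.sum_nonneg fun _ _ => mul_self_nonneg _)

/-! ### The common neighbours of an edge -/

/-- The number of ordered pairs of common neighbours of `x` and `y` that are at distance `2`. -/
noncomputable def commonNbrsDistTwo (G : SimpleGraph V) (x y : V) : ℕ :=
  ((G.commonNbrs x y ×ˢ G.commonNbrs x y).filter fun p => G.dist p.1 p.2 = 2).card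

theorem IsDistanceRegular.sum_commonNbrs (hG : G.IsDistanceRegular) {x y : V}
    (hxy : G.Adj x y) (g : ℕ → ℝ) :
    ∑ z ∈ G.commonNbrs x y, ∑ w ∈ G.commonNbrs x y, g (G.dist z w) =
      G.drgA 1 * g 0 + G.commonNbrsDistTwo x y * g 2 +
        (G.drgA 1 ^ 2 - G.drgA 1 - G.commonNbrsDistTwo x y) * g 1 := by
  classical
  rw [← hG.card_commonNbrs hxy, commonNbrsDistTwo]
  set D := G.commonNbrs x y with hD
  have key : ∀ p ∈ D ×ˢ D, g (G.dist p.1 p.2) =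
      (if p.1 = p.2 then g 0 - g 1 else 0) + (if G.dist p.1 p.2 = 2 then g 2 - g 1 else 0)
        + g 1 := by
    rintro ⟨z, w⟩ hp
    obtain ⟨hz, hw⟩ := Finset.mem_product.1 hp
    have h1 := dist_eq_one_iff_adj.2 (mem_commonNbrs.1 hz).1.symm
    have h2 := dist_eq_one_iff_adj.2 (mem_commonNbrs.1 hw).1
    have := hG.1.dist_triangle (u := z) (v := x) (w := w)
    dsimp only at *
    rcases eq_or_ne z w with rfl | hne
    · simp
    · have h0 := hG.1.pos_dist_of_ne hne
      have h12 : G.dist z w = 1 ∨ G.dist z w = 2 := by lia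
      rcases h12 with h | h <;> simp [h, hne]
  rw [← Finset.sum_product' D D (fun z w => g (G.dist z w)), Finset.sum_congr rfl key,
    Finset.sum_add_distrib, Finset.sum_add_distrib, ← Finset.sum_filter, ← Finset.sum_filter]
  have hdiag : (D ×ˢ D).filter (fun p => p.1 = p.2) = D.diag := by
    ext ⟨z, w⟩
    simp only [Finset.mem_filter, Finset.mem_product, Finset.mem_diag]
    grind
  simp only [Finset.sum_const, nsmul_eq_mul, hdiag, Finset.diag_card, Finset.card_product]
  push_cast
  ring

/-- For adjacent `x, y` with characteristic vectors `x̂, ŷ` and `w` the characteristic vector of the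
set of common neighbours, the form of the cosine sequence of `t` is nonnegative on the span of
`x̂ + ŷ` and `w`. Its determinant there, divided by `2 (k - t) / b₁`, is the difference of
the two sides. -/
theorem IsDistanceRegular.commonNbrsDistTwo_mul_le [DecidableEq V] [DecidableRel G.Adj]
    (hG : G.IsDistanceRegular) (hd : 2 ≤ G.diam) {t : ℝ}
    (ht : Module.End.HasEigenvalue (Matrix.toLin' (G.adjMatrix ℝ)) t)
    (hpos : 0 < G.drgValency + t) (hlt : t < G.drgValency) {x y : V} (hxy : G.Adj x y) :
    G.commonNbrsDistTwo x y * ((G.drgValency + t) * (1 + t)) ≤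
      G.drgA 1 * (G.drgB 1 * (G.drgValency + t * (G.drgA 1 + 1))) := by
  obtain ⟨g, g0, g1, g2, hpsd⟩ := hG.exists_cosine hd ht
  have hS := hG.sum_commonNbrs hxy g
  have hcard := hG.card_commonNbrs hxy
  have hk := hG.valency_eq hd hxy
  have hb : (0 : ℝ) < G.drgB 1 := by exact_mod_cast hG.drgB_one_pos hd
  set D := G.commonNbrs x y
  set a : ℝ := (G.drgA 1 : ℝ)
  set b : ℝ := (G.drgB 1 : ℝ)
  set k : ℝ := (G.drgValency : ℝ)
  set N : ℝ := (G.commonNbrsDistTwo x y : ℝ)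
  have hquad : ∀ α β : ℝ, 0 ≤ 2 * α * (α * (k + t) + β * (a * t)) +
      β * (2 * α * t * a + β * (a * k + N * g 2 + (a ^ 2 - a - N) * t)) := by
    intro α β
    -- `v = α (x̂ + ŷ) + β w`
    let v : V → ℝ := fun z => α * ((if z = x then 1 else 0) + (if z = y then 1 else 0)) +
      β * (if z ∈ D then 1 else 0)
    have hv : ∀ f : V → ℝ, ∑ z, v z * f z = α * (f x + f y) + β * ∑ z ∈ D, f z := by
      intro f
      simp [v, add_mul, mul_assoc, Finset.sum_add_distrib, ← Finset.mul_sum]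
    have h := hpsd v
    simp only [hv] at h
    have hx : ∀ w ∈ D, g (G.dist x w) = t := fun w hw => by
      rw [dist_eq_one_iff_adj.2 (mem_commonNbrs.1 hw).1, g1]
    have hy : ∀ w ∈ D, g (G.dist y w) = t := fun w hw => by
      rw [dist_eq_one_iff_adj.2 (mem_commonNbrs.1 hw).2, g1]
    have hin : ∑ z ∈ D, (α * (g (G.dist z x) + g (G.dist z y)) + β * ∑ w ∈ D, g (G.dist z w)) =
        2 * α * t * a + β * (a * k + N * g 2 + (a ^ 2 - a - N) * t) := by
      rw [Finset.sum_add_distrib, ← Finset.mul_sum (a := β), hS, g0, g1]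
      rw [Finset.sum_congr rfl (g := fun _ => α * (t + t)), Finset.sum_const, hcard, nsmul_eq_mul]
      · ring
      · intro z hz
        rw [dist_comm (u := z), hx z hz, dist_comm (u := z), hy z hz]
    rw [hin, Finset.sum_congr rfl hx, Finset.sum_congr rfl hy, Finset.sum_const, hcard,
      nsmul_eq_mul, dist_self, dist_self, dist_comm (u := y), dist_eq_one_iff_adj.2 hxy, g0,
      g1] at h
    linarith
  have hg2 : g 2 = (t ^ 2 - k - a * t) / b := by field_simp; linarith
  -- this combination of `x̂ + ŷ` and `w` is orthogonal to `x̂ + ŷ`, so the form is the determinant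
  -- up to a factor
  have hfac : 0 ≤ (k + t) * (k - t) *
      (a * (b * (k + t * (a + 1))) - N * ((k + t) * (1 + t))) / b := by
    refine (hquad (-(a * t)) (k + t)).trans_eq ?_
    rw [hg2, hk]
    field_simp
    ring
  have h1 : 0 < (k + t) * (k - t) / b :=
    div_pos (mul_pos hpos (sub_pos.2 hlt)) hb
  have h2 : 0 ≤ a * (b * (k + t * (a + 1))) - N * ((k + t) * (1 + t)) := by
    refine nonneg_of_mul_nonneg_right (hfac.trans_eq ?_) h1
    ring
  linarith

/-! ### Location of the eigenvalues -/

theorem _root_.Matrix.IsSymm.dotProduct_mulVec_nonneg_of_eigenvalues {n : Type*} [Fintype n]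
    [DecidableEq n] {S : Matrix n n ℝ} (hS : S.IsSymm)
    (h : ∀ (l : ℝ) (u : n → ℝ), u ≠ 0 → S.mulVec u = l • u → 0 ≤ l) (v : n → ℝ) :
    0 ≤ v ⬝ᵥ S.mulVec v := by
  have hH : S.IsHermitian := by
    rw [Matrix.IsHermitian, Matrix.conjTranspose_eq_transpose_of_trivial]; exact hS
  have hP : S.PosSemidef := hH.posSemidef_iff_eigenvalues_nonneg.2 fun i =>
    h _ _ (fun h0 => hH.eigenvectorBasis.orthonormal.ne_zero i (by ext j; exact congrFun h0 j))
      (hH.mulVec_eigenvectorBasis i)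
  simpa using hP.dotProduct_mulVec_nonneg v

theorem _root_.Matrix.hasEigenvalue_toLin'_of_mulVec {n : Type*} [Fintype n] [DecidableEq n]
    {S : Matrix n n ℝ} {l : ℝ} {u : n → ℝ} (hu : u ≠ 0) (h : S.mulVec u = l • u) :
    Module.End.HasEigenvalue (Matrix.toLin' S) l :=
  Module.End.hasEigenvalue_of_hasEigenvector
    ⟨Module.End.mem_eigenspace_iff.2 (by rw [Matrix.toLin'_apply, h]), hu⟩

/-- For `ε = 1` the left side is twice the quadratic form of the Laplacian, for `ε = -1` twice that
of the signless Laplacian. Being a sum of squares, it bounds the eigenvalues by the degree and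
describes the eigenvectors when the bound is attained. -/
theorem sum_sum_sub_mul_sq [DecidableRel G.Adj] {k : ℕ} (hk : ∀ x, G.degree x = k)
    {ε : ℝ} (hε : ε ^ 2 = 1) {t : ℝ} {u : V → ℝ} (hu : (G.adjMatrix ℝ).mulVec u = t • u) :
    ∑ x, ∑ z ∈ G.neighborFinset x, (u x - ε * u z) ^ 2 = 2 * (k - ε * t) * ∑ x, u x ^ 2 := by
  have h1 : ∑ x, ∑ z ∈ G.neighborFinset x, u z ^ 2 = k * ∑ x, u x ^ 2 := by
    have : ∀ x, ∑ z ∈ G.neighborFinset x, u z ^ 2 = ∑ z, if G.Adj x z then u z ^ 2 else 0 := by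
      intro x
      rw [← Finset.sum_filter]
      refine Finset.sum_congr ?_ fun _ _ => rfl
      ext; simp
    simp only [this]
    rw [Finset.sum_comm, Finset.mul_sum]
    refine Finset.sum_congr rfl fun z _ => ?_
    rw [← Finset.sum_filter, Finset.sum_const, nsmul_eq_mul, ← hk z,
      ← card_neighborFinset_eq_degree]
    congr 3
    ext; simp [adj_comm]
  have h2 : ∀ x, ∑ z ∈ G.neighborFinset x, u z = t * u x := fun x => by
    have := congrFun hu x
    rwa [adjMatrix_mulVec_apply] at this
  have h3 : ∀ x, ∑ z ∈ G.neighborFinset x, (u x - ε * u z) ^ 2 =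
      (k - 2 * ε * t) * u x ^ 2 + ∑ z ∈ G.neighborFinset x, u z ^ 2 := by
    intro x
    have : ∀ z, (u x - ε * u z) ^ 2 = u x ^ 2 - 2 * ε * u x * u z + u z ^ 2 := fun z => by
      linear_combination u z ^ 2 * hε
    simp only [this]
    rw [Finset.sum_add_distrib, Finset.sum_sub_distrib, ← Finset.mul_sum, h2, Finset.sum_const,
      card_neighborFinset_eq_degree, hk, nsmul_eq_mul]
    ring
  simp only [h3]
  rw [Finset.sum_add_distrib, h1, ← Finset.mul_sum]
  ring

theorem mul_eigenvalue_le_degree [DecidableRel G.Adj] {k : ℕ} (hk : ∀ x, G.degree x = k)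
    {ε : ℝ} (hε : ε ^ 2 = 1) {t : ℝ} {u : V → ℝ} (hu0 : u ≠ 0)
    (hu : (G.adjMatrix ℝ).mulVec u = t • u) : ε * t ≤ k := by
  have h := sum_sum_sub_mul_sq hk hε hu
  have h1 : 0 ≤ ∑ x, ∑ z ∈ G.neighborFinset x, (u x - ε * u z) ^ 2 :=
    Finset.sum_nonneg fun _ _ => Finset.sum_nonneg fun _ _ => sq_nonneg _
  have h2 : 0 < ∑ x, u x ^ 2 := by
    obtain ⟨x, hx⟩ := Function.ne_iff.1 hu0
    exact Finset.sum_pos' (fun _ _ => sq_nonneg _) ⟨x, Finset.mem_univ _, by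
      have : u x ≠ 0 := hx
      positivity⟩
  rw [h] at h1
  have := nonneg_of_mul_nonneg_left h1 h2
  linarith

theorem eq_mul_of_adj_of_eigenvalue_eq [DecidableRel G.Adj] {k : ℕ} (hk : ∀ x, G.degree x = k)
    {ε : ℝ} (hε : ε ^ 2 = 1) {u : V → ℝ}
    (hu : (G.adjMatrix ℝ).mulVec u = (ε * k) • u) {x z : V} (hxz : G.Adj x z) :
    u x = ε * u z := by
  have h := sum_sum_sub_mul_sq hk hε hu
  have h0 : (k : ℝ) - ε * (ε * k) = 0 := by linear_combination -(k : ℝ) * hε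
  rw [h0, mul_zero, zero_mul,
    Finset.sum_eq_zero_iff_of_nonneg fun _ _ => Finset.sum_nonneg fun _ _ => sq_nonneg _] at h
  have h1 := (Finset.sum_eq_zero_iff_of_nonneg fun _ _ => sq_nonneg _).1 (h x (Finset.mem_univ _))
    z ((G.mem_neighborFinset x z).2 hxz)
  linarith [pow_eq_zero_iff (two_ne_zero) |>.1 h1]

/-- An eigenvector for `-k` changes sign along each edge, so two adjacent vertices never have the
same distance to a third vertex. -/
theorem IsDistanceRegular.isDRGBipartite_of_eigenvalue [DecidableRel G.Adj]
    (hG : G.IsDistanceRegular) (hd : 1 ≤ G.diam) {u : V → ℝ} (hu0 : u ≠ 0)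
    (hu : (G.adjMatrix ℝ).mulVec u = (-(G.drgValency : ℝ)) • u) : G.IsDRGBipartite := by
  have hadj : ∀ {x z}, G.Adj x z → u x = - u z := fun {x z} h => by
    have := eq_mul_of_adj_of_eigenvalue_eq (ε := -1) (hG.degree_eq hd) (by norm_num)
      (by rw [hu]; ring_nf) h
    linarith
  have hwalk : ∀ {x z} (p : G.Walk x z), u x = (-1) ^ p.length * u z := by
    intro x z p
    induction p with
    | nil => simp
    | cons h p ih => rw [hadj h, ih, Walk.length_cons, pow_succ]; ring
  have hdist : ∀ x z, u x = (-1) ^ G.dist x z * u z := fun x z => by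
    obtain ⟨p, hp⟩ := hG.1.exists_walk_length_eq_dist x z
    rw [← hp]
    exact hwalk p
  obtain ⟨w, hw⟩ := Function.ne_iff.1 hu0
  have hne : ∀ x, u x ≠ 0 := fun x h0 => hw (by
    rw [hdist w x, h0]; simp)
  intro i hi
  unfold drgA intersectionNumber
  have hsub : {n : ℕ | ∃ x y : V, G.dist x y = i ∧ G.sphereInterCard 1 i x y = n} ⊆ {0} := by
    rintro n ⟨x, y, hxy, rfl⟩
    rw [Set.mem_singleton_iff, sphereInterCard, Finset.card_eq_zero, Finset.filter_eq_empty_iff]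
    rintro z - ⟨hz1, hz2⟩
    have e1 := hadj (dist_eq_one_iff_adj.1 hz1)
    have e2 := hdist x y
    have e3 := hdist z y
    rw [dist_comm, hz2] at e3
    rw [hxy] at e2
    exact hne x (by linarith)
  rcases Set.subset_singleton_iff_eq.1 hsub with h | h <;> simp [h]

/-- The smallest eigenvalue is less than `-1`: the Rayleigh quotient of `1, -1, 1` on an induced path
`x, y, z` is `-4/3`. -/
theorem eigenvalue_lt_neg_one [DecidableEq V] [DecidableRel G.Adj] {t : ℝ}
    (hmin : ∀ l, Module.End.HasEigenvalue (Matrix.toLin' (G.adjMatrix ℝ)) l → t ≤ l)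
    {x y z : V} (hxy : G.Adj x y) (hyz : G.Adj y z) (hn : ¬ G.Adj x z) (hne : x ≠ z) :
    t < -1 := by
  have h := Matrix.IsSymm.dotProduct_mulVec_nonneg_of_eigenvalues
    (S := G.adjMatrix ℝ - t • 1)
    ((G.isSymm_adjMatrix (α := ℝ)).sub (Matrix.isSymm_one.smul t))
    (fun l u hu hl => by
      have := hmin (l + t) (Matrix.hasEigenvalue_toLin'_of_mulVec hu (by
        rw [Matrix.sub_mulVec, Matrix.smul_mulVec, Matrix.one_mulVec, sub_eq_iff_eq_add] at hl
        rw [hl, add_smul]))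
      linarith)
    (Pi.single x 1 - Pi.single y 1 + Pi.single z 1)
  have hn' : ¬ G.Adj z x := fun h => hn h.symm
  simp [Matrix.mulVec_add, Matrix.mulVec_sub, add_dotProduct, sub_dotProduct, hxy, hxy.symm, hyz,
    hyz.symm, hn, hn', hne, hne.symm, hxy.ne, hxy.ne', hyz.ne, hyz.ne'] at h
  linarith

/-- A vector with entries `1, -1` on two nonadjacent vertices `x, z` is orthogonal to the constants,
and its Rayleigh quotient is `0`. The proof tests `t • 1 - A + (k - t) • J` on it, where `J` is the
all-ones matrix; adding the multiple of `J` makes that matrix positive semidefinite on the constants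
too. -/
theorem eigenvalue_nonneg [DecidableEq V] [DecidableRel G.Adj] {k : ℕ}
    (hconn : G.Connected) (hk : ∀ x, G.degree x = k) {t : ℝ} (htk : t ≤ k)
    (hmax : ∀ l, Module.End.HasEigenvalue (Matrix.toLin' (G.adjMatrix ℝ)) l → l ≠ k → l ≤ t)
    {x z : V} (hn : ¬ G.Adj x z) (hne : x ≠ z) : 0 ≤ t := by
  let J : Matrix V V ℝ := Matrix.of fun _ _ => 1
  have hJ : ∀ u, J.mulVec u = fun _ => ∑ w, u w := fun u => by
    ext i; simp [J, Matrix.mulVec, dotProduct]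
  have hAs : ∀ u, ∑ i, (G.adjMatrix ℝ).mulVec u i = k * ∑ w, u w := fun u => by
    have h1 : (1 : V → ℝ) ⬝ᵥ (G.adjMatrix ℝ).mulVec u = k * ∑ w, u w := by
      rw [Matrix.dotProduct_mulVec, ← Matrix.mulVec_transpose, transpose_adjMatrix]
      simp [dotProduct, adjMatrix_mulVec_apply, hk, Finset.mul_sum]
    simpa [dotProduct] using h1
  have hcard : (1 : ℝ) ≤ Fintype.card V := by
    have : Nonempty V := ⟨x⟩
    exact_mod_cast Fintype.card_pos (α := V)
  have hn' : ¬ G.Adj z x := fun h => hn h.symm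
  have h := Matrix.IsSymm.dotProduct_mulVec_nonneg_of_eigenvalues
    (S := t • 1 - G.adjMatrix ℝ + ((k : ℝ) - t) • J)
    (((Matrix.isSymm_one.smul t).sub (G.isSymm_adjMatrix (α := ℝ))).add
      (Matrix.IsSymm.smul (by ext; rfl) _))
    (fun l u hu hl => by
      rw [Matrix.add_mulVec, Matrix.sub_mulVec, Matrix.smul_mulVec, Matrix.one_mulVec,
        Matrix.smul_mulVec, hJ] at hl
      -- if the sum of `u` is nonzero, summing coordinates shows that `l` is the eigenvalue of `1`
      by_cases hs : ∑ w, u w = 0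
      · have hA : (G.adjMatrix ℝ).mulVec u = (t - l) • u := by
          rw [sub_smul, ← hl, hs]
          ext i; simp
        by_cases hlk : t - l = k
        · rw [hlk] at hA
          -- an eigenvector for `k` is constant, and its sum vanishes
          have hadj : ∀ {a b}, G.Adj a b → u a = u b := fun {a b} h => by
            have := eq_mul_of_adj_of_eigenvalue_eq (ε := 1) hk (by norm_num) (by simpa using hA) h
            simpa using this
          have hconst : ∀ a, u a = u x := fun a => by
            obtain ⟨p⟩ := hconn.preconnected a x
            induction p with
            | nil => rfl
            | cons h p ih => rw [hadj h]; exact ih hn hne hn'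
          exfalso
          refine hu (funext fun a => ?_)
          simp only [hconst, Finset.sum_const, nsmul_eq_mul, Finset.card_univ] at hs ⊢
          rcases mul_eq_zero.1 hs with h0 | h0
          · linarith
          · simpa using h0
        · have := hmax _ (Matrix.hasEigenvalue_toLin'_of_mulVec hu hA) hlk
          linarith
      · have hsum : ((t - k) + (k - t) * Fintype.card V) * ∑ w, u w = l * ∑ w, u w := by
          have := congrArg (fun f : V → ℝ => ∑ i, f i) hl
          simp only [Pi.add_apply, Pi.sub_apply, Pi.smul_apply, smul_eq_mul,
            Finset.sum_add_distrib, Finset.sum_sub_distrib, ← Finset.mul_sum, hAs,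
            Finset.sum_const, Finset.card_univ, nsmul_eq_mul] at this
          linarith
        rw [← mul_right_cancel₀ hs hsum]
        nlinarith)
    (Pi.single x 1 - Pi.single z 1)
  have hJ0 : J.mulVec (Pi.single x 1 - Pi.single z 1) = 0 := by
    rw [hJ]; ext; simp
  rw [Matrix.add_mulVec, Matrix.smul_mulVec, hJ0] at h
  simp [Matrix.mulVec_sub, sub_dotProduct, hn, hn', hne, hne.symm] at h
  linarith

end SimpleGraph

/-! ### The fundamental bound -/

/-- The fundamental bound with cleared denominators, for an eigenvalue `s` above `-1` and an
eigenvalue `t` below `-1`; in a bipartite graph `t = -k` is allowed, since there `a₁ = 0`. -/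
theorem SimpleGraph.IsDistanceRegular.fundamental_bound {V : Type*} [Fintype V] [DecidableEq V]
    {G : SimpleGraph V} [DecidableRel G.Adj] (hG : G.IsDistanceRegular) (hd : 2 ≤ G.diam)
    {s t : ℝ} (hs : Module.End.HasEigenvalue (Matrix.toLin' (G.adjMatrix ℝ)) s)
    (ht : Module.End.HasEigenvalue (Matrix.toLin' (G.adjMatrix ℝ)) t)
    (hs0 : -1 < s) (hsk : s < G.drgValency) (ht1 : t < -1) (htk : -(G.drgValency : ℝ) ≤ t)
    (hbip : ¬ G.IsDRGBipartite → -(G.drgValency : ℝ) < t) :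
    0 ≤ ((G.drgA 1 + 1) * (s * t) + G.drgValency * (s + t)
      + G.drgValency * (G.drgValency - G.drgA 1) : ℝ) := by
  obtain ⟨x, y, -, hxy, -⟩ := hG.exists_induced_path hd
  have hk0 : (0 : ℝ) ≤ G.drgValency := Nat.cast_nonneg _
  rcases Nat.eq_zero_or_pos (G.drgA 1) with ha | ha
  · have : (0 : ℝ) ≤ (s + G.drgValency) * (t + G.drgValency) :=
      mul_nonneg (by linarith) (by linarith)
    rw [ha, Nat.cast_zero]
    linarith
  · have htk' := hbip fun h => by
      have := h 1 (by lia)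
      lia
    have e1 := hG.commonNbrsDistTwo_mul_le hd hs (by linarith) hsk hxy
    have e2 := hG.commonNbrsDistTwo_mul_le hd ht (by linarith) (by linarith) hxy
    have hb : (0 : ℝ) < G.drgB 1 := by exact_mod_cast hG.drgB_one_pos hd
    have ha' : (0 : ℝ) < G.drgA 1 := by exact_mod_cast ha
    generalize (G.drgValency : ℝ) = k at *
    generalize (G.drgA 1 : ℝ) = a at *
    generalize (G.drgB 1 : ℝ) = b at *
    generalize (G.commonNbrsDistTwo x y : ℝ) = N at *
    -- eliminate `N` between an upper bound (from `s`) and a lower bound (from `t`)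
    have p1 : 0 ≤ -((k + t) * (1 + t)) := by nlinarith
    have p2 : 0 ≤ (k + s) * (1 + s) := mul_nonneg (by linarith) (by linarith)
    have q1 := mul_le_mul_of_nonneg_right e1 p1
    have q2 := mul_le_mul_of_nonneg_right e2 p2
    have h : 0 ≤ a * b * (s - t) * ((a + 1) * (s * t) + k * (s + t) + k * (k - a)) := by
      linarith
    exact nonneg_of_mul_nonneg_right h (mul_pos (mul_pos ha' hb) (by linarith))

theorem theorem6p2 {V : Type*} [Fintype V] [DecidableEq V] (G : SimpleGraph V)
    [DecidableRel G.Adj] (hG : G.IsDistanceRegular)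
    (d : ℕ) (hd : G.diam = d) (hd3 : 3 ≤ d)
    -- `θ 0 > θ 1 > ... > θ d` are the eigenvalues of the adjacency matrix
    (θ : Fin (d + 1) → ℝ) (hθ : StrictAnti θ)
    (hθ_eig : ∀ t : ℝ,
      Module.End.HasEigenvalue (Matrix.toLin' (G.adjMatrix ℝ)) t ↔ t ∈ Set.range θ)
    (k a₁ b₁ θ₁ θd : ℝ) (hk : k = G.drgValency) (ha₁ : a₁ = G.drgA 1) (hb₁ : b₁ = G.drgB 1)
    (hθ₁ : θ₁ = θ 1) (hθd : θd = θ (Fin.last d)) :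
    (¬ G.IsDRGBipartite →
      (k + θd) * (1 + θd) ≠ 0 ∧ (k + θ₁) * (1 + θ₁) ≠ 0 ∧
      (k + θd * (a₁ + 1)) / ((k + θd) * (1 + θd)) ≤
        (k + θ₁ * (a₁ + 1)) / ((k + θ₁) * (1 + θ₁))) ∧
    (θ₁ + k / (a₁ + 1)) * (θd + k / (a₁ + 1)) ≥ -(k * a₁ * b₁ / (a₁ + 1) ^ 2) := by
  have hd2 : 2 ≤ G.diam := by lia
  have hdeg := hG.degree_eq (by lia)
  obtain ⟨x, y, z, hxy, hyz, hn, hne⟩ := hG.exists_induced_path hd2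
  have hmem : ∀ i, Module.End.HasEigenvalue (Matrix.toLin' (G.adjMatrix ℝ)) (θ i) := fun i =>
    (hθ_eig _).2 ⟨i, rfl⟩
  have hvec : ∀ t, Module.End.HasEigenvalue (Matrix.toLin' (G.adjMatrix ℝ)) t →
      ∃ u : V → ℝ, u ≠ 0 ∧ (G.adjMatrix ℝ).mulVec u = t • u := fun t ht => by
    obtain ⟨u, hu⟩ := ht.exists_hasEigenvector
    exact ⟨u, hu.2, by simpa using hu.apply_eq_smul⟩
  have hle : ∀ i, θ i ≤ G.drgValency := fun i => by
    obtain ⟨u, hu0, hu⟩ := hvec _ (hmem i)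
    simpa using SimpleGraph.mul_eigenvalue_le_degree hdeg (ε := 1) (by norm_num) hu0 hu
  have hge : ∀ i, -(G.drgValency : ℝ) ≤ θ i := fun i => by
    obtain ⟨u, hu0, hu⟩ := hvec _ (hmem i)
    have := SimpleGraph.mul_eigenvalue_le_degree hdeg (ε := -1) (by norm_num) hu0 hu
    linarith
  have hone : ((1 : Fin (d + 1)) : ℕ) = 1 := by
    rw [Fin.val_one', Nat.mod_eq_of_lt (by lia)]
  have h01 : (0 : Fin (d + 1)) < 1 := by
    rw [Fin.lt_def, hone]
    simp
  have hlt1 : θ 1 < G.drgValency := (hθ h01).trans_le (hle 0)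
  have hlast : θ (Fin.last d) < -1 := SimpleGraph.eigenvalue_lt_neg_one (fun l hl => by
    obtain ⟨i, rfl⟩ := (hθ_eig l).1 hl
    exact hθ.antitone (Fin.le_last i)) hxy hyz hn hne
  -- the valency is an eigenvalue, hence it is `θ 0`
  have h0 : θ 0 = G.drgValency := by
    obtain ⟨i, hi⟩ := (hθ_eig G.drgValency).1 (Matrix.hasEigenvalue_toLin'_of_mulVec
      (u := fun _ => 1) (fun h => one_ne_zero (congrFun h x)) (by
        ext w
        simp [SimpleGraph.adjMatrix_mulVec_apply, hdeg]))
    exact le_antisymm (hle 0) (hi ▸ hθ.antitone (Fin.zero_le i))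
  have hnn : 0 ≤ θ 1 := SimpleGraph.eigenvalue_nonneg hG.1 hdeg hlt1.le (fun l hl hlk => by
    obtain ⟨i, rfl⟩ := (hθ_eig l).1 hl
    refine hθ.antitone ?_
    have hi : i ≠ 0 := fun h => hlk (h ▸ h0)
    rw [Fin.le_def, hone]
    exact Nat.one_le_iff_ne_zero.2 (Fin.val_ne_zero_iff.2 hi)) hn hne
  have hbip : ¬ G.IsDRGBipartite → -(G.drgValency : ℝ) < θ (Fin.last d) := fun hb =>
    lt_of_le_of_ne (hge _) fun h => by
      obtain ⟨u, hu0, hu⟩ := hvec _ (hmem (Fin.last d))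
      exact hb (hG.isDRGBipartite_of_eigenvalue (by lia) hu0 (h ▸ hu))
  have key := hG.fundamental_bound hd2 (hmem 1) (hmem (Fin.last d)) (by linarith) hlt1 hlast
    (hge _) hbip
  have hkab := hG.valency_eq hd2 hxy
  have ha0 : (0 : ℝ) ≤ G.drgA 1 := Nat.cast_nonneg _
  rw [← hk, ← ha₁, ← hθ₁, ← hθd] at key
  rw [← hk, ← hθd] at hbip
  rw [← hk, ← ha₁, ← hb₁] at hkab
  rw [← hθd] at hlast
  rw [← hθ₁, ← hk] at hlt1
  rw [← hθ₁] at hnn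
  rw [← ha₁] at ha0
  refine ⟨fun hb => ?_, ?_⟩
  · have hkd := hbip hb
    have n1 : (k + θd) * (1 + θd) < 0 := mul_neg_of_pos_of_neg (by linarith) (by linarith)
    have n2 : 0 < (k + θ₁) * (1 + θ₁) := mul_pos (by linarith) (by linarith)
    refine ⟨n1.ne, n2.ne', ?_⟩
    rw [div_le_iff_of_neg n1, div_mul_eq_mul_div, div_le_iff₀ n2]
    have h := mul_nonneg (sub_nonneg.2 (hlast.le.trans (by linarith : (-1 : ℝ) ≤ θ₁))) key
    linarith
  · rw [ge_iff_le, ← sub_nonneg]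
    have h : (θ₁ + k / (a₁ + 1)) * (θd + k / (a₁ + 1)) - -(k * a₁ * b₁ / (a₁ + 1) ^ 2) =
        ((a₁ + 1) * (θ₁ * θd) + k * (θ₁ + θd) + k * (k - a₁)) / (a₁ + 1) := by
      have hb' : b₁ = k - 1 - a₁ := by linarith
      rw [hb']
      field_simp
      ring
    rw [h]
    exact div_nonneg key (by linarith)
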